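/- Let $n,k\ge 2$. A state on $\mathbb C^n\otimes\mathbb C^k$ is a positive semidefinite matrix $\rho\in M_n(\mathbb C)\otimes M_k(\mathbb C)\cong M_{nk}(\mathbb C)$ with $\operatorname{Tr}\rho=1$. For $X\in M_n(\mathbb C)\otimes M_k(\mathbb C)$ put $$X^\Gamma=(\mathrm{id}_n\otimes\Theta)(X),\qquad X^{red}=(\mathrm{id}_n\otimes\mathrm{Tr})(X)\otimes I_k-X,$$ where $\Theta$ is the transposition on $M_k(\mathbb C)$. Let $\mathrm{APPT}_{n,k}$ (respectively $\mathrm{ARED}_{n,k}$) be the set of states $\rho$ such that $(U\rho U^*)^\Gamma\ge 0$ (respectively $(U\rho U^*)^{red}\ge 0$) for every unitary matrix $U$ of size $nk$. For $1\le p\le nk$ let $\mathrm{LS}_p$ be the set of states whose eigenvalues $\lambda_1\ge\lambda_2\ge\dots\ge\lambda_{nk}$, counted with multiplicity, satisfy $$\lambda_1\le\lambda_{nk-p+1}+\lambda_{nk-p+2}+\dots+\lambda_{nk},$$ i.e. the largest eigenvalue is at most the sum of the $p$ smallest ones. **Theorem.** If $n,k\ge 3$, then $$\mathrm{APPT}_{n,k}\subseteq\mathrm{LS}_3\subseteq\mathrm{LS}_k\subseteq\mathrm{ARED}_{n,k}\subseteq\mathrm{LS}_{2k-1}.$$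 More precisely, for all $n,k\ge 2$: 1. $\mathrm{APPT}_{n,k}\subseteq\mathrm{LS}_3$. 2. If $\min(n,k)\in\{2,3\}$, then $\mathrm{LS}_2\subseteq\mathrm{APPT}_{n,k}$; if $\min(n,k)\ge 4$, then $\mathrm{LS}_2\not\subseteq\mathrm{APPT}_{n,k}$. 3. $\mathrm{APPT}_{n,k}\not\subseteq\mathrm{LS}_2$. 4. $\mathrm{LS}_k\subseteq\mathrm{ARED}_{n,k}$. 5. $\mathrm{ARED}_{n,k}\subseteq\mathrm{LS}_{2k-1}$. -/

import Mathlib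

open scoped ComplexOrder Kronecker

namespace BipartiteSpectra

/-- The density matrices with rows and columns indexed by `ι`:
positive semidefinite complex matrices of trace one. -/
def densityMatrices (ι : Type) [Fintype ι] : Set (Matrix ι ι ℂ) :=
  {ρ | ρ.PosSemidef ∧ ρ.trace = 1}

/-- The partial transposition `(id ⊗ Θ)(X)`, acting on the second tensor factor;
`M_n(ℂ) ⊗ M_k(ℂ)` is realised as the matrices indexed by `Fin n × Fin k`. -/
def partialTranspose {n k : ℕ} (X : Matrix (Fin n × Fin k) (Fin n × Fin k) ℂ) :
    Matrix (Fin n × Fin k) (Fin n × Fin k) ℂ :=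
  Matrix.of fun p q => X (p.1, q.2) (q.1, p.2)

/-- The partial trace `X_A = (id ⊗ Tr)(X)` over the second tensor factor. -/
def partialTrace {n k : ℕ} (X : Matrix (Fin n × Fin k) (Fin n × Fin k) ℂ) :
    Matrix (Fin n) (Fin n) ℂ :=
  Matrix.of fun i j => ∑ a : Fin k, X (i, a) (j, a)

/-- The reduction `X ↦ X_A ⊗ I_k - X` over the second tensor factor. -/
def reduction {n k : ℕ} (X : Matrix (Fin n × Fin k) (Fin n × Fin k) ℂ) :
    Matrix (Fin n × Fin k) (Fin n × Fin k) ℂ :=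
  partialTrace X ⊗ₖ (1 : Matrix (Fin k) (Fin k) ℂ) - X

/-- The states with positive semidefinite partial transpose. -/
def PPT (n k : ℕ) : Set (Matrix (Fin n × Fin k) (Fin n × Fin k) ℂ) :=
  {ρ | ρ ∈ densityMatrices (Fin n × Fin k) ∧ (partialTranspose ρ).PosSemidef}

/-- The states with positive semidefinite reduction over the second tensor factor. -/
def RED (n k : ℕ) : Set (Matrix (Fin n × Fin k) (Fin n × Fin k) ℂ) :=
  {ρ | ρ ∈ densityMatrices (Fin n × Fin k) ∧ (reduction ρ).PosSemidef}

/-- The states all of whose unitary conjugates lie in `C`. -/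
def absolutely {ι : Type} [Fintype ι] [DecidableEq ι] (C : Set (Matrix ι ι ℂ)) :
    Set (Matrix ι ι ℂ) :=
  {ρ | ρ ∈ densityMatrices ι ∧
    ∀ U ∈ Matrix.unitaryGroup ι ℂ, U * ρ * star U ∈ C}

/-- The absolutely PPT states. -/
def APPT (n k : ℕ) : Set (Matrix (Fin n × Fin k) (Fin n × Fin k) ℂ) :=
  absolutely (PPT n k)

/-- The absolutely RED states. -/
def ARED (n k : ℕ) : Set (Matrix (Fin n × Fin k) (Fin n × Fin k) ℂ) :=
  absolutely (RED n k)

/-- The decreasing rearrangement of a real vector (`v ∘ Tuple.sort v` is the increasing one). -/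
noncomputable def decreasing {d : ℕ} (v : Fin d → ℝ) : Fin d → ℝ :=
  fun i => v (Tuple.sort v i.rev)

/-- The probability vectors of length `d` whose largest entry is at most the sum of the `p`
smallest ones. With indices starting at `0`, the latter are the entries of the decreasing
rearrangement at the indices `d - p, …, d - 1`. -/
def LS (d p : ℕ) : Set (Fin d → ℝ) :=
  {v | v ∈ stdSimplex ℝ (Fin d) ∧ ∃ hd : 0 < d,
    decreasing v ⟨0, hd⟩ ≤ ∑ i ∈ Finset.univ.filter (fun i : Fin d => d ≤ (i : ℕ) + p), decreasing v i}

/-- The density matrices whose vector of eigenvalues (with multiplicities) lies in `A`,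
a set that is invariant under permutations of the entries. -/
def statesWithSpectrumIn (ι : Type) [Fintype ι] [DecidableEq ι]
    (A : Set (Fin (Fintype.card ι) → ℝ)) : Set (Matrix ι ι ℂ) :=
  {ρ | ρ ∈ densityMatrices ι ∧ ∃ h : ρ.IsHermitian, h.eigenvalues₀ ∈ A}

/-- The set `LS_p`, as a set of states on `ℂⁿ ⊗ ℂᵏ`. -/
def LSStates (n k p : ℕ) : Set (Matrix (Fin n × Fin k) (Fin n × Fin k) ℂ) :=
  statesWithSpectrumIn (Fin n × Fin k) (LS (Fintype.card (Fin n × Fin k)) p)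

end BipartiteSpectra

/-!
Positivity of `Γ(σ)`, or of the reduction of `σ`, is tested on vectors `x`. Both maps are
self-adjoint for the trace pairing, so the test reads `0 ≤ Tr (σ A)` with `A` the image of the
rank-one matrix `x x*`, and everything is a matter of pairing the spectrum of `σ` with that of `A`.

*Sufficient conditions.* The sets `LS_p` are unitarily invariant, so `LS_p ⊆ C` already puts `LS_p`
inside the absolute version of `C` (`statesWithSpectrumIn_LS_subset_absolutely`).

For the reduction, `A = X_A ⊗ 1 - X` with `X = x x*`. Since `0 ≤ X_A ⊗ 1 ≤ Tr X` and
`Tr (X_A ⊗ 1) = k Tr X`, Ky Fan's principle (`sum_smallest_eigenvalues_le_trace_mul`) bounds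
`Tr (ρ (X_A ⊗ 1))` below by `Tr X` times the sum of the `k` smallest eigenvalues of `ρ`, while
`Tr (ρ X) ≤ λ₁ Tr X`.

For the partial transpose, `A = Γ(x x*)` has `Tr A = s` and `Tr A² = s²` with `s = ‖x‖²`, because
`Γ` preserves the trace and the trace pairing, and it has rank at most `min(n, k)²`. If
`min(n, k) ≤ 3`, Cauchy-Schwarz on the at most nine nonzero eigenvalues gives `‖A‖₁ ≤ 3 s`, so the
negative part of `A` has trace at most `s`. No Schmidt decomposition is needed; the rest is the
inequality `sum_mul_weights_nonneg` about doubly stochastic weights.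

*Necessary conditions.* If `ρ` is absolutely in `C`, its eigenbasis may be prescribed. The
test vector is `x = e₀ ⊗ e₀ + e₁ ⊗ e₁`: for either map the matrix `A` has a single negative
eigenvalue, and the eigenvalues of `A` are equal up to sign on a subspace spanned by standard basis
vectors and the image of two of them under a Hadamard rotation (`planeHadamard_conj`).

*Counterexamples.* For `min(n, k) ≥ 4` the state proportional to `1 + P`, with `P` the
antisymmetric projection of a copy of `ℂ⁴ ⊗ ℂ⁴`, lies in `LS_2` but is not PPT. Conversely, a
Hermitian matrix of size `d` with `Tr A = Tr A² = 1` satisfies `A ≥ -(d - 2) / d`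
(`posSemidef_one_add_smul`); hence the state with spectrum proportional to
`(1 + d / (d - 2), 1, …, 1)` is absolutely PPT, and it is not in `LS_2`.
-/

namespace BipartiteSpectra

open Matrix

/-! ### Spectra and the sets `LS_p` -/

theorem decreasing_eq_self {d : ℕ} {v : Fin d → ℝ} (h : Antitone v) : decreasing v = v := by
  have h1 : v ∘ Fin.revPerm = v ∘ Tuple.sort v :=
    Tuple.comp_sort_eq_comp_iff_monotone.mpr fun i j hij => h (Fin.rev_le_rev.mpr hij)
  funext i
  have := congrFun h1 i.rev
  simpa [decreasing] using this.symm

section Spectrum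

variable {ι : Type} [Fintype ι] [DecidableEq ι] {ρ : Matrix ι ι ℂ}

theorem eigenvalues₀_eq_eigenvalues (h : ρ.IsHermitian) (i : Fin (Fintype.card ι)) :
    h.eigenvalues₀ i = h.eigenvalues (Fintype.equivOfCardEq (Fintype.card_fin _) i) := by
  simp [IsHermitian.eigenvalues]

theorem sum_eigenvalues₀ (h : ρ.IsHermitian) : ∑ i, h.eigenvalues₀ i = ρ.trace.re := by
  simp_rw [eigenvalues₀_eq_eigenvalues]
  rw [Equiv.sum_comp _ h.eigenvalues, h.trace_eq_sum_eigenvalues]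
  simp

theorem mem_statesWithSpectrumIn_LS_iff {p : ℕ} (h : ρ.IsHermitian) :
    ρ ∈ statesWithSpectrumIn ι (LS (Fintype.card ι) p) ↔
      ρ ∈ densityMatrices ι ∧ ∃ hd : 0 < Fintype.card ι, h.eigenvalues₀ ⟨0, hd⟩ ≤
        ∑ i ∈ Finset.univ.filter (fun i : Fin (Fintype.card ι) => Fintype.card ι ≤ (i : ℕ) + p),
          h.eigenvalues₀ i := by
  simp only [statesWithSpectrumIn, LS, Set.mem_ofPred_eq,
    decreasing_eq_self h.eigenvalues₀_antitone]
  refine and_congr_right fun hρ => ⟨fun ⟨_, _, h2⟩ => h2, fun h2 => ⟨h, ⟨fun i => ?_, ?_⟩, h2⟩⟩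
  · rw [eigenvalues₀_eq_eigenvalues]
    exact hρ.1.eigenvalues_nonneg _
  · rw [sum_eigenvalues₀, hρ.2, Complex.one_re]

theorem eigenvalues₀_conj {U : Matrix ι ι ℂ} (hU : U ∈ unitaryGroup ι ℂ) (h : ρ.IsHermitian)
    (h' : (U * ρ * star U).IsHermitian) : h'.eigenvalues₀ = h.eigenvalues₀ := by
  have hc : (U * ρ * star U).charpoly = ρ.charpoly := by
    rw [charpoly_mul_comm, ← mul_assoc, mem_unitaryGroup_iff'.mp hU, one_mul]
  simp_rw [← List.ofFn_inj, ← IsHermitian.sort_roots_charpoly_eq_eigenvalues₀, hc]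

theorem conj_mem_densityMatrices {U : Matrix ι ι ℂ} (hU : U ∈ unitaryGroup ι ℂ)
    (h : ρ ∈ densityMatrices ι) : U * ρ * star U ∈ densityMatrices ι := by
  refine ⟨h.1.mul_mul_conjTranspose_same U, ?_⟩
  rw [trace_mul_comm, ← mul_assoc, mem_unitaryGroup_iff'.mp hU, one_mul, h.2]

/-- The sets `LS_p` are unitarily invariant, so any larger set contains them absolutely. -/
theorem statesWithSpectrumIn_LS_subset_absolutely {p : ℕ} {C : Set (Matrix ι ι ℂ)}
    (hC : statesWithSpectrumIn ι (LS (Fintype.card ι) p) ⊆ C) :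
    statesWithSpectrumIn ι (LS (Fintype.card ι) p) ⊆ absolutely C := by
  intro ρ hρ
  refine ⟨hρ.1, fun U hU => hC ?_⟩
  have h := hρ.1.1.isHermitian
  have hd := conj_mem_densityMatrices hU hρ.1
  rw [mem_statesWithSpectrumIn_LS_iff hd.1.isHermitian, eigenvalues₀_conj hU h]
  exact ⟨hd, ((mem_statesWithSpectrumIn_LS_iff h).mp hρ).2⟩

theorem statesWithSpectrumIn_LS_mono {p q : ℕ} (hpq : p ≤ q) :
    statesWithSpectrumIn ι (LS (Fintype.card ι) p) ⊆
      statesWithSpectrumIn ι (LS (Fintype.card ι) q) := by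
  intro ρ hρ
  have h := hρ.1.1.isHermitian
  have h0 : ∀ i, 0 ≤ h.eigenvalues₀ i := fun i => by
    rw [eigenvalues₀_eq_eigenvalues]
    exact hρ.1.1.eigenvalues_nonneg _
  obtain ⟨h1, hd, h2⟩ := (mem_statesWithSpectrumIn_LS_iff h).mp hρ
  refine (mem_statesWithSpectrumIn_LS_iff h).mpr ⟨h1, hd, h2.trans ?_⟩
  refine Finset.sum_le_sum_of_subset_of_nonneg (fun i hi => ?_) fun i _ _ => h0 i
  simp only [Finset.mem_filter, Finset.mem_univ, true_and] at hi ⊢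
  omega

/-! ### Pairing a matrix with the spectrum of another one -/

/-- The diagonal of `B` in the chosen eigenbasis of `ρ`, as real numbers; this loses nothing when
`B` is Hermitian, the only case of interest. -/
noncomputable def eigenDiag (h : ρ.IsHermitian) (B : Matrix ι ι ℂ) (j : ι) : ℝ :=
  ((star (h.eigenvectorUnitary : Matrix ι ι ℂ) * B * (h.eigenvectorUnitary : Matrix ι ι ℂ)) j j).re

theorem trace_mul_eq_sum_eigenDiag (h : ρ.IsHermitian) (B : Matrix ι ι ℂ) :
    (ρ * B).trace.re = ∑ j, h.eigenvalues j * eigenDiag h B j := by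
  conv_lhs => rw [h.spectral_theorem, Unitary.conjStarAlgAut_apply, mul_assoc, mul_assoc,
    trace_mul_comm, mul_assoc, mul_assoc]
  simp [trace, diagonal_mul, eigenDiag, mul_assoc]

theorem sum_eigenDiag (h : ρ.IsHermitian) (B : Matrix ι ι ℂ) :
    ∑ j, eigenDiag h B j = B.trace.re := by
  have : (star (h.eigenvectorUnitary : Matrix ι ι ℂ) * B *
      (h.eigenvectorUnitary : Matrix ι ι ℂ)).trace = B.trace := by
    rw [trace_mul_comm, ← mul_assoc, ← Unitary.coe_star, Unitary.coe_mul_star_self, one_mul]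
  rw [← this]
  simp [trace, eigenDiag]

theorem eigenDiag_nonneg (h : ρ.IsHermitian) {B : Matrix ι ι ℂ} (hB : B.PosSemidef) (j : ι) :
    0 ≤ eigenDiag h B j :=
  (Complex.nonneg_iff.mp
    (hB.conjTranspose_mul_mul_same (h.eigenvectorUnitary : Matrix ι ι ℂ)).diag_nonneg).1

theorem eigenDiag_sub (h : ρ.IsHermitian) (A B : Matrix ι ι ℂ) (j : ι) :
    eigenDiag h (A - B) j = eigenDiag h A j - eigenDiag h B j := by
  simp [eigenDiag, mul_sub, sub_mul]

theorem eigenDiag_smul_one (h : ρ.IsHermitian) (c : ℝ) (j : ι) :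
    eigenDiag h ((c : ℂ) • (1 : Matrix ι ι ℂ)) j = c := by
  simp [eigenDiag]

theorem eigenDiag_self (h : ρ.IsHermitian) (j : ι) : eigenDiag h ρ j = h.eigenvalues j := by
  have := h.conjStarAlgAut_star_eigenvectorUnitary
  rw [Unitary.conjStarAlgAut_star_apply] at this
  rw [eigenDiag, this]
  simp

theorem le_eigenvalues_of_posSemidef_sub (h : ρ.IsHermitian) {c : ℝ}
    (hc : (ρ - (c : ℂ) • 1).PosSemidef) (j : ι) : c ≤ h.eigenvalues j := by
  have := eigenDiag_nonneg h hc j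
  rw [eigenDiag_sub, eigenDiag_self, eigenDiag_smul_one] at this
  linarith

theorem eigenvalues_le_of_posSemidef_sub (h : ρ.IsHermitian) {c : ℝ}
    (hc : ((c : ℂ) • 1 - ρ).PosSemidef) (j : ι) : h.eigenvalues j ≤ c := by
  have := eigenDiag_nonneg h hc j
  rw [eigenDiag_sub, eigenDiag_self, eigenDiag_smul_one] at this
  linarith

theorem trace_mul_le_eigenvalues₀_zero (h : ρ.IsHermitian) (hd : 0 < Fintype.card ι)
    {B : Matrix ι ι ℂ} (hB : B.PosSemidef) :
    (ρ * B).trace.re ≤ h.eigenvalues₀ ⟨0, hd⟩ * B.trace.re := by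
  rw [trace_mul_eq_sum_eigenDiag h, ← sum_eigenDiag h, Finset.mul_sum]
  exact Finset.sum_le_sum fun j _ => mul_le_mul_of_nonneg_right
    (h.eigenvalues₀_antitone (Fin.mk_le_of_le_val (Nat.zero_le _))) (eigenDiag_nonneg h hB j)

theorem card_filter_last {d p : ℕ} (hp : p ≤ d) :
    (Finset.univ.filter fun i : Fin d => d ≤ (i : ℕ) + p).card = p := by
  have h := Fin.card_filter_val_lt (n := d) (m := d - p)
  have h2 := Finset.card_filter_add_card_filter_not (s := (Finset.univ : Finset (Fin d)))
    (fun i : Fin d => (i : ℕ) < d - p)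
  have h3 : (Finset.univ.filter fun i : Fin d => ¬ (i : ℕ) < d - p) =
      Finset.univ.filter fun i : Fin d => d ≤ (i : ℕ) + p := by
    ext i; simp
  rw [h3, h, Finset.card_fin] at h2
  omega

/-- Among the weights in `[0, c]` of total mass `p * c`, the weighted sum of a decreasing sequence
is minimised by putting the weight `c` on the last `p` entries. -/
theorem bathtub {d p : ℕ} (hp : 0 < p) (hpd : p ≤ d) {v w : Fin d → ℝ} (hv : Antitone v) {c : ℝ}
    (hw0 : ∀ i, 0 ≤ w i) (hwc : ∀ i, w i ≤ c) (hw : ∑ i, w i = p * c) :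
    c * ∑ i ∈ Finset.univ.filter (fun i : Fin d => d ≤ (i : ℕ) + p), v i ≤ ∑ i, v i * w i := by
  -- `m` is the first of the last `p` indices, and `u` the extremal weight. Comparing with the
  -- threshold `v m` makes every term of `∑ (w - u) (v - v m)` nonnegative.
  let m : Fin d := ⟨d - p, by omega⟩
  let u : Fin d → ℝ := fun i => if d ≤ (i : ℕ) + p then c else 0
  have hu : ∑ i, u i = p * c := by
    simp [u, ← Finset.sum_filter, card_filter_last hpd]
  have h1 : ∀ i, 0 ≤ (w i - u i) * (v i - v m) := by
    intro i
    by_cases hi : d ≤ (i : ℕ) + p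
    · have : v i ≤ v m := hv (Fin.le_def.mpr (by simp only [m]; omega))
      simp only [u, hi, if_true]
      exact mul_nonneg_of_nonpos_of_nonpos (by linarith [hwc i]) (by linarith)
    · have : v m ≤ v i := hv (Fin.le_def.mpr (by simp only [m]; omega))
      simp only [u, hi, if_false]
      exact mul_nonneg (by linarith [hw0 i]) (by linarith)
  have h2 : ∑ i, (w i - u i) * (v i - v m) = ∑ i, v i * w i - ∑ i, v i * u i := by
    have : ∀ i, (w i - u i) * (v i - v m) = v i * w i - v i * u i - v m * (w i - u i) := by
      intro i; ring
    simp_rw [this, Finset.sum_sub_distrib, ← Finset.mul_sum, Finset.sum_sub_distrib, hw, hu]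
    ring
  have h3 : ∑ i, v i * u i =
      c * ∑ i ∈ Finset.univ.filter (fun i : Fin d => d ≤ (i : ℕ) + p), v i := by
    simp [u, Finset.mul_sum, Finset.sum_filter, mul_comm]
  have := Finset.sum_nonneg fun i (_ : i ∈ Finset.univ) => h1 i
  linarith

/-- Ky Fan's minimum principle, with a matrix `0 ≤ B ≤ c` of trace `p * c` in place of a projection
of rank `p`. -/
theorem sum_smallest_eigenvalues_le_trace_mul (h : ρ.IsHermitian) {p : ℕ} (hp : 0 < p)
    (hpd : p ≤ Fintype.card ι) {B : Matrix ι ι ℂ} {c : ℝ} (hB : B.PosSemidef)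
    (hBc : ((c : ℂ) • 1 - B).PosSemidef) (hBt : B.trace.re = p * c) :
    c * ∑ i ∈ Finset.univ.filter
        (fun i : Fin (Fintype.card ι) => Fintype.card ι ≤ (i : ℕ) + p), h.eigenvalues₀ i ≤
      (ρ * B).trace.re := by
  let e : Fin (Fintype.card ι) ≃ ι := Fintype.equivOfCardEq (Fintype.card_fin _)
  have h1 : (ρ * B).trace.re = ∑ i, h.eigenvalues₀ i * eigenDiag h B (e i) := by
    rw [trace_mul_eq_sum_eigenDiag h, ← e.sum_comp]
    simp [e, IsHermitian.eigenvalues]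
  rw [h1]
  refine bathtub hp hpd h.eigenvalues₀_antitone (fun i => eigenDiag_nonneg h hB _) (fun i => ?_) ?_
  · have := eigenDiag_nonneg h hBc (e i)
    rw [eigenDiag_sub, eigenDiag_smul_one] at this
    linarith
  · rw [e.sum_comp (eigenDiag h B), sum_eigenDiag, hBt]

theorem sum_last_two {d : ℕ} (hd : 2 ≤ d) (v : Fin d → ℝ) :
    ∑ i ∈ Finset.univ.filter (fun i : Fin d => d ≤ (i : ℕ) + 2), v i =
      v ⟨d - 2, by omega⟩ + v ⟨d - 1, by omega⟩ := by
  rw [← Finset.sum_pair (by simp only [ne_eq, Fin.mk.injEq]; omega)]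
  congr 1
  ext i
  simp only [Finset.mem_filter, Finset.mem_univ, true_and, Finset.mem_insert,
    Finset.mem_singleton, Fin.ext_iff]
  omega

/-- The trace pairing of two Hermitian matrices through a doubly stochastic matrix. -/
theorem exists_doublyStochastic_trace_mul {A : Matrix ι ι ℂ} (h : ρ.IsHermitian)
    (hA : A.IsHermitian) : ∃ w : ι → ι → ℝ, (∀ i j, 0 ≤ w i j) ∧ (∀ j, ∑ i, w i j = 1) ∧
      (∀ i, ∑ j, w i j = 1) ∧
      (ρ * A).trace.re = ∑ j, hA.eigenvalues j * ∑ i, h.eigenvalues i * w i j := by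
  -- `w i j` is the squared modulus of the inner product of the `i`-th eigenvector of `ρ` and the
  -- `j`-th one of `A`, obtained here from the spectral projections `P j` of `A`.
  let P : ι → Matrix ι ι ℂ := fun j => (hA.eigenvectorUnitary : Matrix ι ι ℂ) * single j j 1 *
    star (hA.eigenvectorUnitary : Matrix ι ι ℂ)
  have hP : ∀ j, (P j).PosSemidef := fun j => by
    have : (single j j (1 : ℂ)).PosSemidef := by
      rw [← diagonal_single]
      exact PosSemidef.diagonal (by intro i; by_cases hi : i = j <;> simp [hi])
    exact this.mul_mul_conjTranspose_same _
  have hPA : ∑ j, (hA.eigenvalues j : ℂ) • P j = A := by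
    conv_rhs => rw [hA.spectral_theorem, Unitary.conjStarAlgAut_apply]
    rw [← sum_single_eq_diagonal, Finset.mul_sum, Finset.sum_mul]
    refine Finset.sum_congr rfl fun j _ => ?_
    rw [← smul_mul_assoc, ← mul_smul_comm, smul_single]
    simp
  have hP1 : ∑ j, P j = 1 := by
    simp only [P, ← Finset.sum_mul, ← Finset.mul_sum, sum_single_one, mul_one]
    exact Unitary.coe_mul_star_self _
  refine ⟨fun i j => eigenDiag h (P j) i, fun i j => eigenDiag_nonneg h (hP j) i, ?_, ?_, ?_⟩
  · intro j
    rw [sum_eigenDiag]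
    simp only [P]
    rw [trace_mul_comm, ← mul_assoc]
    simp
  · intro i
    have := eigenDiag_smul_one h 1 i
    rw [Complex.ofReal_one, one_smul, ← hP1] at this
    rw [← this]
    simp [eigenDiag, Finset.mul_sum, Finset.sum_mul, Matrix.sum_apply]
  · conv_lhs => rw [← hPA]
    simp_rw [← trace_mul_eq_sum_eigenDiag]
    simp [Finset.mul_sum, trace_sum]

end Spectrum

/-! ### Partial transposition and reduction under the trace pairing -/

section Pairing

variable {n k : ℕ}

theorem partialTranspose_partialTranspose (X : Matrix (Fin n × Fin k) (Fin n × Fin k) ℂ) :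
    partialTranspose (partialTranspose X) = X := rfl

theorem isHermitian_partialTranspose {X : Matrix (Fin n × Fin k) (Fin n × Fin k) ℂ}
    (h : X.IsHermitian) : (partialTranspose X).IsHermitian := by
  ext i j
  simp only [conjTranspose_apply, partialTranspose, of_apply]
  exact h.apply _ _

theorem trace_partialTranspose (X : Matrix (Fin n × Fin k) (Fin n × Fin k) ℂ) :
    (partialTranspose X).trace = X.trace := rfl

/-- Partial transposition is self-adjoint for the trace pairing. -/
theorem trace_partialTranspose_mul (X Y : Matrix (Fin n × Fin k) (Fin n × Fin k) ℂ) :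
    (partialTranspose X * Y).trace = (X * partialTranspose Y).trace := by
  simp only [trace, diag_apply, mul_apply, partialTranspose, of_apply, Fintype.sum_prod_type]
  refine Finset.sum_congr rfl fun i _ => ?_
  rw [Finset.sum_comm]
  conv_rhs => rw [Finset.sum_comm]
  refine Finset.sum_congr rfl fun j _ => ?_
  rw [Finset.sum_comm]

theorem isHermitian_partialTrace {X : Matrix (Fin n × Fin k) (Fin n × Fin k) ℂ}
    (h : X.IsHermitian) : (partialTrace X).IsHermitian := by
  ext i j
  simp only [conjTranspose_apply, partialTrace, of_apply, star_sum]
  exact Finset.sum_congr rfl fun a _ => h.apply _ _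

theorem isHermitian_reduction {X : Matrix (Fin n × Fin k) (Fin n × Fin k) ℂ}
    (h : X.IsHermitian) : (reduction X).IsHermitian := by
  refine IsHermitian.sub ?_ h
  rw [IsHermitian, conjTranspose_kronecker, isHermitian_partialTrace h, conjTranspose_one]

theorem trace_kronecker_one_mul (A : Matrix (Fin n) (Fin n) ℂ)
    (Y : Matrix (Fin n × Fin k) (Fin n × Fin k) ℂ) :
    ((A ⊗ₖ (1 : Matrix (Fin k) (Fin k) ℂ)) * Y).trace = (A * partialTrace Y).trace := by
  simp only [trace, diag_apply, mul_apply, partialTrace, of_apply, Fintype.sum_prod_type,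
    kroneckerMap_apply, one_apply, mul_ite, mul_one, mul_zero, ite_mul, zero_mul,
    Finset.sum_ite_eq, Finset.mem_univ, if_true, Finset.mul_sum]
  exact Finset.sum_congr rfl fun i _ => Finset.sum_comm

/-- The reduction map is self-adjoint for the trace pairing. -/
theorem trace_reduction_mul (X Y : Matrix (Fin n × Fin k) (Fin n × Fin k) ℂ) :
    (reduction X * Y).trace = (X * reduction Y).trace := by
  rw [reduction, reduction, sub_mul, mul_sub, trace_sub, trace_sub, trace_kronecker_one_mul,
    trace_mul_comm X (partialTrace Y ⊗ₖ 1), trace_kronecker_one_mul,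
    trace_mul_comm (partialTrace X)]

end Pairing

/-! ### Quadratic forms as traces -/

section Forms

variable {ι : Type} [Fintype ι]

theorem trace_mul_vecMulVec_star (M : Matrix ι ι ℂ) (x : ι → ℂ) :
    (M * vecMulVec x (star x)).trace = star x ⬝ᵥ M *ᵥ x := by
  rw [mul_vecMulVec, trace_vecMulVec, dotProduct_comm]

theorem posSemidef_of_trace_nonneg {M : Matrix ι ι ℂ} (hM : M.IsHermitian)
    (h : ∀ x : ι → ℂ, 0 ≤ (M * vecMulVec x (star x)).trace.re) : M.PosSemidef := by
  refine posSemidef_iff_dotProduct_mulVec.mpr ⟨hM, fun x => ?_⟩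
  rw [Complex.nonneg_iff, ← trace_mul_vecMulVec_star]
  refine ⟨h x, ?_⟩
  rw [trace_mul_vecMulVec_star]
  exact (hM.im_star_dotProduct_mulVec_self x).symm

theorem trace_vecMulVec_star (x : ι → ℂ) :
    (vecMulVec x (star x)).trace = ((∑ i, ‖x i‖ ^ 2 : ℝ) : ℂ) := by
  simp [trace_vecMulVec, dotProduct, Complex.mul_conj, Complex.normSq_eq_norm_sq]

theorem trace_vecMulVec_star_mul_self (x : ι → ℂ) :
    (vecMulVec x (star x) * vecMulVec x (star x)).trace = ((∑ i, ‖x i‖ ^ 2 : ℝ) : ℂ) ^ 2 := by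
  rw [vecMulVec_mul_vecMulVec, vecMulVec_smul, trace_smul, trace_vecMulVec_star, dotProduct_comm,
    ← trace_vecMulVec, trace_vecMulVec_star, smul_eq_mul, sq]

/-- A positive semidefinite matrix is bounded by its trace. -/
theorem posSemidef_trace_smul_one_sub [DecidableEq ι] {T : Matrix ι ι ℂ} (hT : T.PosSemidef) :
    ((T.trace.re : ℂ) • 1 - T).PosSemidef := by
  have h1 : ((T.trace.re : ℂ) • (1 : Matrix ι ι ℂ)).IsHermitian := by
    simp [IsHermitian, conjTranspose_smul]
  refine posSemidef_of_trace_nonneg (h1.sub hT.isHermitian) fun x => ?_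
  have h := hT.isHermitian
  have hle : ∀ j, h.eigenvalues j ≤ T.trace.re := fun j => by
    rw [← sum_eigenDiag h T]
    simp_rw [eigenDiag_self]
    exact Finset.single_le_sum (fun i _ => hT.eigenvalues_nonneg i) (Finset.mem_univ j)
  rw [sub_mul, trace_sub, Complex.sub_re, trace_mul_eq_sum_eigenDiag h, smul_mul_assoc, one_mul,
    trace_smul, smul_eq_mul, Complex.re_ofReal_mul, ← sum_eigenDiag h (vecMulVec x (star x)),
    Finset.mul_sum, sub_nonneg]
  exact Finset.sum_le_sum fun j _ => mul_le_mul_of_nonneg_right (hle j)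
    (eigenDiag_nonneg h (posSemidef_vecMulVec_self_star x) j)

/-- The quadratic form of a positive semidefinite matrix at the sum of two basis vectors. -/
theorem posSemidef_entries [DecidableEq ι] {M : Matrix ι ι ℂ} (hM : M.PosSemidef) (p q : ι) :
    0 ≤ (M p p + M q q + M p q + M q p).re := by
  have h := (posSemidef_iff_dotProduct_mulVec.mp hM).2 (Pi.single p 1 + Pi.single q 1)
  have := (Complex.nonneg_iff.mp h).1
  simp [star_add, mulVec_add, Pi.star_single, add_dotProduct] at this
  simp
  linarith

end Forms

/-! ### `LS_k` and the reduction -/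

section Reduction

variable {n k : ℕ}

theorem partialTrace_eq_sum_submatrix (X : Matrix (Fin n × Fin k) (Fin n × Fin k) ℂ) :
    partialTrace X = ∑ a, X.submatrix (fun i => (i, a)) (fun i => (i, a)) := by
  ext i j
  simp [partialTrace, Matrix.sum_apply]

/-- With `X = x x*`, the matrix `X_A ⊗ 1` lies between `0` and `Tr X` and has trace `k * Tr X`, so
that Ky Fan's principle applies to it. -/
theorem LSStates_subset_RED (hn : 0 < n) (hk : 0 < k) : LSStates n k k ⊆ RED n k := by
  intro ρ hρ
  have h := hρ.1.1.isHermitian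
  obtain ⟨h1, hd, h2⟩ := (mem_statesWithSpectrumIn_LS_iff h).mp hρ
  refine ⟨h1, posSemidef_of_trace_nonneg (isHermitian_reduction h) fun x => ?_⟩
  set X := vecMulVec x (star x) with hX
  have hXp : X.PosSemidef := posSemidef_vecMulVec_self_star x
  have hT : (partialTrace X).PosSemidef := by
    rw [partialTrace_eq_sum_submatrix]
    exact posSemidef_sum _ fun a _ => hXp.submatrix _
  have hTt : (partialTrace X).trace = X.trace := by
    simp [trace, partialTrace, Fintype.sum_prod_type]
  set c := X.trace.re with hc
  have hc0 : 0 ≤ c := (Complex.nonneg_iff.mp hXp.trace_nonneg).1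
  have h3 := sum_smallest_eigenvalues_le_trace_mul (c := c) h hk
    (by simpa using Nat.le_mul_of_pos_left k hn) (hT.kronecker (PosSemidef.one (n := Fin k)))
    (by
      have := (posSemidef_trace_smul_one_sub hT).kronecker (PosSemidef.one (n := Fin k) (R := ℂ))
      rwa [show ((partialTrace X).trace.re : ℂ) • 1 - partialTrace X =
        ((partialTrace X).trace.re : ℂ) • 1 + (-1 : ℂ) • partialTrace X by
          rw [neg_one_smul, sub_eq_add_neg], add_kronecker, smul_kronecker, smul_kronecker,
        one_kronecker_one, hTt, neg_one_smul, ← sub_eq_add_neg] at this)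
    (by rw [trace_kronecker, hTt]; simp [hc, mul_comm])
  have h4 := trace_mul_le_eigenvalues₀_zero h hd hXp
  rw [trace_reduction_mul, reduction, mul_sub, trace_sub, Complex.sub_re]
  nlinarith [mul_le_mul_of_nonneg_left h2 hc0]

end Reduction

/-! ### `LS_2` and the partial transpose for `min(n, k) ≤ 3` -/

section PPTCriterion

/-- Here `v` stands for the spectrum of a state in `LS_2`, with `v i₀` its smallest and `b` its
second smallest entry, `μ` for the spectrum of the partially transposed rank-one matrix, and `w` for
the doubly stochastic matrix relating the two eigenbases. The hypotheses on `μ` say that no entry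
exceeds the sum `s`, and that the negative entries sum to at least `-s`. -/
theorem sum_mul_weights_nonneg {ι : Type} [Fintype ι] [DecidableEq ι] {v μ : ι → ℝ} {w : ι → ι → ℝ}
    (hw0 : ∀ i j, 0 ≤ w i j) (hwc : ∀ j, ∑ i, w i j = 1) (hwr : ∀ i, ∑ j, w i j = 1)
    {i₀ : ι} {b s : ℝ} (ha : 0 ≤ v i₀) (hab : v i₀ ≤ b) (hb : ∀ i, i ≠ i₀ → b ≤ v i)
    (hv : ∀ i, v i ≤ v i₀ + b) (hμ : ∑ j, μ j = s)
    (hμs : ∀ j, μ j ≤ s) (hμa : ∑ j, |μ j| ≤ 3 * s) :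
    0 ≤ ∑ j, μ j * ∑ i, v i * w i j := by
  set a := v i₀ with ha'
  have h1 : ∀ j, b - (b - a) * w i₀ j ≤ ∑ i, v i * w i j := by
    intro j
    have : ∑ i, (b - (b - a) * (if i = i₀ then 1 else 0)) * w i j ≤ ∑ i, v i * w i j := by
      refine Finset.sum_le_sum fun i _ => mul_le_mul_of_nonneg_right ?_ (hw0 i j)
      split_ifs with hi
      · rw [hi]; linarith
      · linarith [hb i hi]
    simp only [sub_mul, Finset.sum_sub_distrib, ← Finset.mul_sum, hwc, mul_assoc, ite_mul, one_mul,
      zero_mul, Finset.sum_ite_eq', Finset.mem_univ, if_true] at this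
    linarith
  have h2 : ∀ j, ∑ i, v i * w i j ≤ (a + b) - b * w i₀ j := by
    intro j
    have : ∑ i, v i * w i j ≤ ∑ i, ((a + b) - b * (if i = i₀ then 1 else 0)) * w i j := by
      refine Finset.sum_le_sum fun i _ => mul_le_mul_of_nonneg_right ?_ (hw0 i j)
      split_ifs with hi
      · rw [hi]; linarith
      · linarith [hv i]
    simp only [sub_mul, Finset.sum_sub_distrib, ← Finset.mul_sum, hwc, mul_assoc, ite_mul, one_mul,
      zero_mul, Finset.sum_ite_eq', Finset.mem_univ, if_true] at this
    linarith
  -- The weighted averages of `v` are written as `b - (b - a) * w i₀ j + m j` with `0 ≤ m j ≤ a`, so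
  -- that the last summand costs at most `a` times the negative part of `μ j`.
  have h3 : ∀ j, b * μ j - (b - a) * (w i₀ j * s) - a * ((|μ j| - μ j) / 2) ≤
      μ j * ∑ i, v i * w i j := by
    intro j
    set r := ∑ i, v i * w i j
    have e1 := h1 j
    have e2 := h2 j
    have e3 := hw0 i₀ j
    have e4 : (b - a) * (w i₀ j * μ j) ≤ (b - a) * (w i₀ j * s) :=
      mul_le_mul_of_nonneg_left (mul_le_mul_of_nonneg_left (hμs j) e3) (by linarith)
    have e5 : - (a * ((|μ j| - μ j) / 2)) ≤ μ j * (r - b + (b - a) * w i₀ j) := by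
      have n0 : 0 ≤ r - b + (b - a) * w i₀ j := by linarith
      have n1 : r - b + (b - a) * w i₀ j ≤ a := by nlinarith
      rcases le_total 0 (μ j) with h | h
      · rw [abs_of_nonneg h]; nlinarith
      · rw [abs_of_nonpos h]; nlinarith
    nlinarith
  have h4 := Finset.sum_le_sum fun j (_ : j ∈ Finset.univ) => h3 j
  simp only [Finset.sum_sub_distrib, ← Finset.mul_sum, ← Finset.sum_mul, ← Finset.sum_div,
    hwr, hμ] at h4
  nlinarith

variable {n k : ℕ}

/-- The partial transpose of `x x*` factors through `ℂⁿ ⊗ ℂⁿ` and through `ℂᵏ ⊗ ℂᵏ`. -/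
theorem rank_partialTranspose_vecMulVec_le (x : Fin n × Fin k → ℂ) :
    (partialTranspose (vecMulVec x (star x))).rank ≤ min n k ^ 2 := by
  have h1 : partialTranspose (vecMulVec x (star x)) =
      (of fun (p : Fin n × Fin k) (q : Fin n × Fin n) =>
        if p.1 = q.1 then star (x (q.2, p.2)) else 0) *
      (of fun (p : Fin n × Fin n) (q : Fin n × Fin k) =>
        if p.2 = q.1 then x (p.1, q.2) else 0) := by
    ext p q
    simp [partialTranspose, mul_apply, vecMulVec_apply, Fintype.sum_prod_type, mul_comm]
  have h2 : partialTranspose (vecMulVec x (star x)) =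
      (of fun (p : Fin n × Fin k) (q : Fin k × Fin k) => if p.2 = q.2 then x (p.1, q.1) else 0) *
      (of fun (p : Fin k × Fin k) (q : Fin n × Fin k) =>
        if p.1 = q.2 then star (x (q.1, p.2)) else 0) := by
    ext p q
    simp [partialTranspose, mul_apply, vecMulVec_apply, Fintype.sum_prod_type]
  rcases le_total n k with h | h
  · rw [min_eq_left h, h1]
    refine (rank_mul_le_left _ _).trans ((rank_le_card_width _).trans ?_)
    simp [sq]
  · rw [min_eq_right h, h2]
    refine (rank_mul_le_left _ _).trans ((rank_le_card_width _).trans ?_)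
    simp [sq]

theorem LSStates_two_subset_PPT (hn : 2 ≤ n) (hk : 2 ≤ k) (hnk : min n k ≤ 3) :
    LSStates n k 2 ⊆ PPT n k := by
  intro ρ hρ
  have h := hρ.1.1.isHermitian
  obtain ⟨h1, hd, h2⟩ := (mem_statesWithSpectrumIn_LS_iff h).mp hρ
  refine ⟨h1, posSemidef_of_trace_nonneg (isHermitian_partialTranspose h) fun x => ?_⟩
  have hd2 : 2 ≤ Fintype.card (Fin n × Fin k) := by simp; nlinarith
  rw [sum_last_two hd2] at h2
  rw [trace_partialTranspose_mul]
  set X := vecMulVec x (star x) with hX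
  have hXp : X.PosSemidef := posSemidef_vecMulVec_self_star x
  have hA := isHermitian_partialTranspose hXp.isHermitian
  set s : ℝ := ∑ i, ‖x i‖ ^ 2
  have hs : 0 ≤ s := Finset.sum_nonneg fun i _ => sq_nonneg _
  obtain ⟨w, hw0, hwc, hwr, hw⟩ := exists_doublyStochastic_trace_mul h hA
  have hμ1 : ∑ j, hA.eigenvalues j = s := by
    simp_rw [← eigenDiag_self hA]
    rw [sum_eigenDiag, trace_partialTranspose, hX, trace_vecMulVec_star, Complex.ofReal_re]
  have hμ2 : ∑ j, hA.eigenvalues j ^ 2 = s ^ 2 := by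
    have := trace_mul_eq_sum_eigenDiag hA (partialTranspose X)
    simp_rw [eigenDiag_self hA] at this
    simp_rw [sq (hA.eigenvalues _)]
    rw [← this, trace_partialTranspose_mul, partialTranspose_partialTranspose, hX,
      trace_vecMulVec_star_mul_self, ← Complex.ofReal_pow, Complex.ofReal_re]
  have hμs : ∀ j, hA.eigenvalues j ≤ s := fun j => by
    refine le_of_sq_le_sq ?_ hs
    rw [← hμ2]
    exact Finset.single_le_sum (f := fun j => hA.eigenvalues j ^ 2) (fun i _ => sq_nonneg _)
      (Finset.mem_univ j)
  have hcard : ((Finset.univ.filter fun j => hA.eigenvalues j ≠ 0).card : ℝ) ≤ 9 := by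
    have e := rank_partialTranspose_vecMulVec_le x
    rw [hA.rank_eq_card_non_zero_eigs, Fintype.card_subtype] at e
    have : min n k ^ 2 ≤ 3 ^ 2 := Nat.pow_le_pow_left hnk 2
    exact_mod_cast e.trans this
  have hμa : ∑ j, |hA.eigenvalues j| ≤ 3 * s := by
    refine le_of_sq_le_sq ?_ (by positivity)
    have e : ∑ j, |hA.eigenvalues j| =
        ∑ j ∈ Finset.univ.filter (fun j => hA.eigenvalues j ≠ 0), |hA.eigenvalues j| := by
      rw [Finset.sum_filter_of_ne]
      intro j _ hj; simpa using hj
    rw [e]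
    refine sq_sum_le_card_mul_sum_sq.trans ?_
    have e2 : ∑ j ∈ Finset.univ.filter (fun j => hA.eigenvalues j ≠ 0), |hA.eigenvalues j| ^ 2 ≤
        s ^ 2 := by
      rw [← hμ2]
      simp_rw [sq_abs]
      exact Finset.sum_le_sum_of_subset_of_nonneg (Finset.filter_subset _ _)
        fun i _ _ => sq_nonneg _
    nlinarith [sq_nonneg s]
  rw [hw]
  let e : Fin (Fintype.card (Fin n × Fin k)) ≃ Fin n × Fin k :=
    Fintype.equivOfCardEq (Fintype.card_fin _)
  have he : ∀ i, h.eigenvalues (e i) = h.eigenvalues₀ i := fun i =>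
    (eigenvalues₀_eq_eigenvalues h i).symm
  refine sum_mul_weights_nonneg (i₀ := e ⟨Fintype.card (Fin n × Fin k) - 1, by omega⟩)
    (b := h.eigenvalues₀ ⟨Fintype.card (Fin n × Fin k) - 2, by omega⟩) hw0 hwc hwr
    (h1.1.eigenvalues_nonneg _) ?_ ?_ ?_ hμ1 hμs hμa
  · rw [he]
    exact h.eigenvalues₀_antitone (Fin.mk_le_mk.mpr (by omega))
  · intro j hj
    obtain ⟨i, rfl⟩ := e.surjective j
    rw [he]
    have hi : (i : ℕ) ≠ Fintype.card (Fin n × Fin k) - 1 := fun hi =>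
      hj (congrArg e (Fin.ext hi))
    exact h.eigenvalues₀_antitone (Fin.le_def.mpr (by simp only; omega))
  · intro j
    obtain ⟨i, rfl⟩ := e.surjective j
    rw [he, he, add_comm]
    exact (h.eigenvalues₀_antitone (Fin.le_def.mpr (Nat.zero_le _))).trans h2

end PPTCriterion

/-! ### Necessary conditions -/

section Necessary

variable {ι : Type} [Fintype ι] [DecidableEq ι]

/-- Absolute membership in `C` lets one prescribe the eigenbasis, and the order in which it is
labelled by the eigenvalues. -/
theorem mul_diagonal_mul_star_mem_of_mem_absolutely {C : Set (Matrix ι ι ℂ)} {ρ : Matrix ι ι ℂ}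
    (hρ : ρ ∈ absolutely C) (h : ρ.IsHermitian) (e : ι ≃ Fin (Fintype.card ι)) {G : Matrix ι ι ℂ}
    (hG : G ∈ unitaryGroup ι ℂ) :
    G * diagonal (fun i => (h.eigenvalues₀ (e i) : ℂ)) * star G ∈ C := by
  let V : Matrix ι ι ℂ := h.eigenvectorUnitary
  have hV : star V * V = 1 := Unitary.coe_star_mul_self _
  let f : ι ≃ ι := e.trans (Fintype.equivOfCardEq (Fintype.card_fin _))
  -- The permutation matrix of `f`; the unitary to use is `G P V*`.
  let P : Matrix ι ι ℂ := (1 : Matrix ι ι ℂ).submatrix f id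
  have hP : P * star P = 1 := by
    ext i j
    simp [P, mul_apply, one_apply, star_apply, eq_comm]
  have hD : P * diagonal (fun j => (h.eigenvalues j : ℂ)) * star P =
      diagonal (fun i => (h.eigenvalues₀ (e i) : ℂ)) := by
    have : P * diagonal (fun j => (h.eigenvalues j : ℂ)) * star P =
        (diagonal (fun j => (h.eigenvalues j : ℂ))).submatrix f f := by
      ext i j
      by_cases hij : i = j <;> simp [P, mul_apply, one_apply, diagonal_apply, star_apply, hij]
    rw [this, submatrix_diagonal_equiv]
    congr 1
    funext i
    simp [f, IsHermitian.eigenvalues]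
  have hU : G * P * star V ∈ unitaryGroup ι ℂ := by
    rw [mem_unitaryGroup_iff] at hG ⊢
    rw [star_mul, star_star, star_mul, mul_assoc (G * P), ← mul_assoc (star V), hV, one_mul,
      mul_assoc G, ← mul_assoc P, hP, one_mul, hG]
  have := hρ.2 _ hU
  have e1 : G * P * star V * ρ * star (G * P * star V) =
      G * (P * (star V * ρ * V) * star P) * star G := by
    simp only [star_mul, star_star, mul_assoc]
  have e2 : star V * ρ * V = diagonal (fun j => (h.eigenvalues j : ℂ)) := by
    have := h.conjStarAlgAut_star_eigenvectorUnitary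
    rwa [Unitary.conjStarAlgAut_star_apply] at this
  rwa [e1, e2, hD] at this

/-- A labelling which sends `i₀` to the first index and `S` to the last ones. -/
theorem exists_equiv_first_last {i₀ : ι} {S : Finset ι} (h0 : i₀ ∉ S)
    (hd : 0 < Fintype.card ι) : ∃ e : ι ≃ Fin (Fintype.card ι), e i₀ = ⟨0, hd⟩ ∧
      S.map e.toEmbedding = Finset.univ.filter
        fun i : Fin (Fintype.card ι) => Fintype.card ι ≤ (i : ℕ) + S.card := by
  set T := Finset.univ.filter fun i : Fin (Fintype.card ι) => Fintype.card ι ≤ (i : ℕ) + S.card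
  have hS : S.card < Fintype.card ι := Finset.card_lt_univ_of_notMem h0
  have hT : S.card = T.card := (card_filter_last hS.le).symm
  have e1 : {x // x ∈ S} ≃ {x // x ∈ T} := Finset.equivOfCardEq hT
  have e2 : {x // ¬ x ∈ S} ≃ {x // ¬ x ∈ T} := Fintype.equivOfCardEq (by
    rw [Fintype.card_subtype_compl, Fintype.card_subtype_compl]
    simp [hT])
  let e3 : ι ≃ Fin (Fintype.card ι) :=
    (Equiv.sumCompl (· ∈ S)).symm.trans ((Equiv.sumCongr e1 e2).trans (Equiv.sumCompl (· ∈ T)))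
  have h3 : ∀ x ∈ S, e3 x ∈ T := fun x hx => by
    simp [e3, Equiv.sumCompl_symm_apply_of_pos hx]
  have h3' : ∀ x ∉ S, e3 x ∉ T := fun x hx => by
    simp only [e3, Equiv.trans_apply, Equiv.sumCompl_symm_apply_of_neg hx, Equiv.sumCongr_apply,
      Sum.map_inr, Equiv.sumCompl_apply_inr]
    exact (e2 ⟨x, hx⟩).2
  have hz : (⟨0, hd⟩ : Fin (Fintype.card ι)) ∉ T := by
    simp only [T, Finset.mem_filter, Finset.mem_univ, true_and]
    omega
  -- `e3` matches `S` with the last indices; the swap moves `i₀` to the front and fixes these.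
  refine ⟨e3.trans (Equiv.swap (e3 i₀) ⟨0, hd⟩), by simp, ?_⟩
  refine Finset.eq_of_subset_of_card_le (fun y hy => ?_) (by simp [hT])
  obtain ⟨x, hx, rfl⟩ := Finset.mem_map.mp hy
  have hx3 := h3 x hx
  simp only [Equiv.coe_toEmbedding, Equiv.trans_apply]
  rwa [Equiv.swap_apply_of_ne_of_ne (fun h => h3' i₀ h0 (by rwa [← h]))
    (fun h => hz (by rwa [← h]))]

/-- The Hadamard rotation in the plane of the basis vectors `p` and `q`, which fixes the other
basis vectors. -/
noncomputable def planeHadamard (p q : ι) : Matrix ι ι ℂ :=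
  of fun i j =>
    if j = p then (if i = p then (√2⁻¹ : ℂ) else 0) + (if i = q then (√2⁻¹ : ℂ) else 0)
    else if j = q then (if i = p then (√2⁻¹ : ℂ) else 0) - (if i = q then (√2⁻¹ : ℂ) else 0)
    else if i = j then 1 else 0

omit [Fintype ι] in
theorem star_planeHadamard {p q : ι} (hpq : p ≠ q) :
    star (planeHadamard p q) = planeHadamard p q := by
  ext i j
  simp only [star_apply, planeHadamard, of_apply]
  by_cases h1 : i = p <;> by_cases h2 : i = q <;> by_cases h3 : j = p <;> by_cases h4 : j = q <;>
    by_cases h5 : i = j <;> simp_all [eq_comm]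

/-- Conjugating a diagonal matrix by `planeHadamard p q` only changes the block of `p` and `q`,
which becomes the one with the eigenvectors `e_p ± e_q`. -/
theorem planeHadamard_conj {p q : ι} (hpq : p ≠ q) (D : ι → ℂ) :
    planeHadamard p q * diagonal D * star (planeHadamard p q) =
      diagonal (fun r => if r = p ∨ r = q then (D p + D q) / 2 else D r) +
        single p q ((D p - D q) / 2) + single q p ((D p - D q) / 2) := by
  have h2 : ((√2 : ℝ) : ℂ)⁻¹ * ((√2 : ℝ) : ℂ)⁻¹ = 1 / 2 := by
    rw [← mul_inv, ← Complex.ofReal_mul, Real.mul_self_sqrt (by norm_num)]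
    norm_num
  rw [star_planeHadamard hpq]
  ext i j
  rw [mul_apply]
  simp only [mul_diagonal]
  by_cases hjp : j = p
  · subst hjp
    by_cases hij : i = j
    · subst hij
      simp [planeHadamard, hpq, hpq.symm, mul_add, Finset.sum_add_distrib]
      linear_combination (D i + D q) * h2
    · by_cases hiq : i = q
      · subst hiq
        simp [planeHadamard, hpq, hpq.symm, mul_add, Finset.sum_add_distrib]
        linear_combination (D j - D i) * h2
      · simp [planeHadamard, hpq.symm, mul_add, Finset.sum_add_distrib, hij, hiq,
          Ne.symm hij, Ne.symm hiq]
  by_cases hjq : j = q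
  · subst hjq
    by_cases hij : i = j
    · subst hij
      simp [planeHadamard, hpq, hpq.symm, mul_sub, Finset.sum_sub_distrib]
      linear_combination (D p + D i) * h2
    · by_cases hip : i = p
      · subst hip
        simp [planeHadamard, hpq, hpq.symm, mul_sub, Finset.sum_sub_distrib]
        linear_combination (D i - D j) * h2
      · simp [planeHadamard, hpq, hpq.symm, mul_sub, Finset.sum_sub_distrib, hij, hip,
          Ne.symm hij, Ne.symm hip]
  · by_cases hij : i = j
    · subst hij
      simp [planeHadamard, hjp, hjq, Ne.symm hjp, Ne.symm hjq]
    · simp [planeHadamard, hjp, hjq, Ne.symm hjp, Ne.symm hjq, hij]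

theorem planeHadamard_mem_unitaryGroup {p q : ι} (hpq : p ≠ q) :
    planeHadamard p q ∈ unitaryGroup ι ℂ := by
  rw [mem_unitaryGroup_iff]
  have := planeHadamard_conj hpq (fun _ => 1)
  simpa using this

/-- The members of `C` which are used as tests for absolute membership: a diagonal matrix `D`,
rotated in the plane of `p` and `q`, with the largest eigenvalue of `ρ` placed at `i₀` and the
smallest ones on `S`. -/
theorem planeHadamard_conj_mem_of_mem_absolutely {C : Set (Matrix ι ι ℂ)} {ρ : Matrix ι ι ℂ}
    (hρ : ρ ∈ absolutely C) (h : ρ.IsHermitian) {p q : ι} (hpq : p ≠ q) {i₀ : ι} {S : Finset ι}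
    (h0 : i₀ ∉ S) (hd : 0 < Fintype.card ι) : ∃ D : ι → ℝ, D i₀ = h.eigenvalues₀ ⟨0, hd⟩ ∧
      ∑ i ∈ S, D i = ∑ i ∈ Finset.univ.filter
        (fun i : Fin (Fintype.card ι) => Fintype.card ι ≤ (i : ℕ) + S.card), h.eigenvalues₀ i ∧
      diagonal (fun r => if r = p ∨ r = q then ((D p : ℂ) + D q) / 2 else D r) +
        single p q (((D p : ℂ) - D q) / 2) + single q p (((D p : ℂ) - D q) / 2) ∈ C := by
  obtain ⟨e, he, heS⟩ := exists_equiv_first_last h0 hd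
  refine ⟨fun i => h.eigenvalues₀ (e i), by simp only [he], ?_, ?_⟩
  · rw [← heS, Finset.sum_map]
    rfl
  · rw [← planeHadamard_conj hpq (fun i => (h.eigenvalues₀ (e i) : ℂ))]
    exact mul_diagonal_mul_star_mem_of_mem_absolutely hρ h e (planeHadamard_mem_unitaryGroup hpq)

variable {n k : ℕ}

/-- The partial transpose of the maximally entangled state of two qubits is half the flip operator,
whose only negative eigenvector is the antisymmetric one. The largest eigenvalue of the state is
put there, and the three smallest ones on the symmetric vectors. -/
theorem APPT_subset_LSStates_three (hn : 2 ≤ n) (hk : 2 ≤ k) : APPT n k ⊆ LSStates n k 3 := by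
  intro ρ hρ
  have h := hρ.1.1.isHermitian
  have hd : 0 < Fintype.card (Fin n × Fin k) := by simp; constructor <;> omega
  let x0 : Fin n := ⟨0, by omega⟩
  let x1 : Fin n := ⟨1, by omega⟩
  let y0 : Fin k := ⟨0, by omega⟩
  let y1 : Fin k := ⟨1, by omega⟩
  have hx : x0 ≠ x1 := by simp [x0, x1]
  have hy : y0 ≠ y1 := by simp [y0, y1]
  obtain ⟨D, hD0, hDS, hC⟩ := planeHadamard_conj_mem_of_mem_absolutely hρ h (p := (x0, y1))
    (q := (x1, y0)) (i₀ := (x1, y0)) (S := {(x0, y0), (x1, y1), (x0, y1)}) (by simp [hx])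
    (by simp [hx.symm, hy]) hd
  have hcard : ({(x0, y0), (x1, y1), (x0, y1)} : Finset (Fin n × Fin k)).card = 3 := by
    rw [Finset.card_eq_three]
    exact ⟨(x0, y0), (x1, y1), (x0, y1), by simp [hx], by simp [hy], by simp [hx.symm], rfl⟩
  have hpos := posSemidef_entries hC.2 (x0, y0) (x1, y1)
  refine (mem_statesWithSpectrumIn_LS_iff h).mpr ⟨hρ.1, hd, ?_⟩
  rw [hcard] at hDS
  rw [← hDS, ← hD0, Finset.sum_insert (by simp [hx, hy]), Finset.sum_pair (by simp [hx.symm])]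
  simp [partialTranspose, hx, hx.symm, hy, hy.symm] at hpos
  linarith

/-- The reduction of the maximally entangled state `x` of two qubits is negative only on `x`; the
largest eigenvalue is put there, and the `2k - 1` smallest ones on its complement in the span of
the `eᵢ ⊗ eₐ` with `i < 2`. -/
theorem ARED_subset_LSStates (hn : 2 ≤ n) (hk : 2 ≤ k) : ARED n k ⊆ LSStates n k (2 * k - 1) := by
  intro ρ hρ
  have h := hρ.1.1.isHermitian
  have hd : 0 < Fintype.card (Fin n × Fin k) := by simp; constructor <;> omega
  let x0 : Fin n := ⟨0, by omega⟩
  let x1 : Fin n := ⟨1, by omega⟩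
  let y0 : Fin k := ⟨0, by omega⟩
  let y1 : Fin k := ⟨1, by omega⟩
  have hx : x0 ≠ x1 := by simp [x0, x1]
  have hy : y0 ≠ y1 := by simp [y0, y1]
  let B : Finset (Fin n × Fin k) := {x0, x1} ×ˢ Finset.univ
  have hB : (x0, y0) ∈ B := by simp [B]
  obtain ⟨D, hD0, hDS, hC⟩ := planeHadamard_conj_mem_of_mem_absolutely hρ h (p := (x0, y0))
    (q := (x1, y1)) (i₀ := (x0, y0)) (S := B.erase (x0, y0)) (by simp [hx])
    (by simp) hd
  have hcard : (B.erase (x0, y0)).card = 2 * k - 1 := by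
    rw [Finset.card_erase_of_mem hB, Finset.card_product, Finset.card_pair hx, Finset.card_fin]
  have hpos := posSemidef_entries hC.2 (x0, y0) (x1, y1)
  refine (mem_statesWithSpectrumIn_LS_iff h).mpr ⟨hρ.1, hd, ?_⟩
  rw [hcard] at hDS
  rw [← hDS, ← hD0]
  have hsum : D (x0, y0) + ∑ i ∈ B.erase (x0, y0), D i = ∑ a, D (x0, a) + ∑ a, D (x1, a) := by
    rw [Finset.add_sum_erase _ _ hB, Finset.sum_product, Finset.sum_pair hx]
  have hdiag0 : ∀ a, ((if (x0, a) = (x0, y0) ∨ (x0, a) = (x1, y1) then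
      ((D (x0, y0) : ℂ) + D (x1, y1)) / 2 else D (x0, a)) : ℂ) =
      ((D (x0, a) + if a = y0 then (D (x1, y1) - D (x0, y0)) / 2 else 0 : ℝ) : ℂ) := fun a => by
    by_cases ha : a = y0
    · subst ha
      simp
      ring
    · simp [ha, hx]
  have hdiag1 : ∀ a, ((if (x1, a) = (x0, y0) ∨ (x1, a) = (x1, y1) then
      ((D (x0, y0) : ℂ) + D (x1, y1)) / 2 else D (x1, a)) : ℂ) =
      ((D (x1, a) + if a = y1 then (D (x0, y0) - D (x1, y1)) / 2 else 0 : ℝ) : ℂ) := fun a => by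
    by_cases ha : a = y1
    · subst ha
      simp
      ring
    · simp [ha, hx.symm]
  simp only [reduction, partialTrace, Matrix.sub_apply, kroneckerMap_apply, of_apply,
    Matrix.add_apply,
    diagonal_apply_eq, hdiag0, hdiag1] at hpos
  simp [hx, hx.symm, hy, hy.symm, Finset.sum_add_distrib] at hpos
  linarith

end Necessary

/-! ### Counterexamples -/

section Counterexamples

variable {n k : ℕ}

theorem inv_smul_mem_densityMatrices {ι : Type} [Fintype ι] {M : Matrix ι ι ℂ}
    (hM : M.PosSemidef) {c : ℝ} (hc : 0 < c) (ht : M.trace = c) :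
    ((c⁻¹ : ℝ) : ℂ) • M ∈ densityMatrices ι := by
  refine ⟨hM.smul (by exact_mod_cast (inv_pos.mpr hc).le), ?_⟩
  rw [trace_smul, ht, smul_eq_mul, ← Complex.ofReal_mul, inv_mul_cancel₀ hc.ne', Complex.ofReal_one]

theorem mem_LSStates_two_of_posSemidef (hnk : 2 ≤ n * k)
    {ρ : Matrix (Fin n × Fin k) (Fin n × Fin k) ℂ} (hρ : ρ ∈ densityMatrices (Fin n × Fin k))
    {a : ℝ} (h1 : (ρ - (a : ℂ) • 1).PosSemidef) (h2 : (((2 * a : ℝ) : ℂ) • 1 - ρ).PosSemidef) :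
    ρ ∈ LSStates n k 2 := by
  have h := hρ.1.isHermitian
  have hd : 2 ≤ Fintype.card (Fin n × Fin k) := by simpa using hnk
  refine (mem_statesWithSpectrumIn_LS_iff h).mpr ⟨hρ, by omega, ?_⟩
  rw [sum_last_two hd]
  simp_rw [eigenvalues₀_eq_eigenvalues]
  linarith [eigenvalues_le_of_posSemidef_sub h h2
      (Fintype.equivOfCardEq (Fintype.card_fin _) ⟨0, by omega⟩),
    le_eigenvalues_of_posSemidef_sub h h1
      (Fintype.equivOfCardEq (Fintype.card_fin _) ⟨Fintype.card (Fin n × Fin k) - 2, by omega⟩),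
    le_eigenvalues_of_posSemidef_sub h h1
      (Fintype.equivOfCardEq (Fintype.card_fin _) ⟨Fintype.card (Fin n × Fin k) - 1, by omega⟩)]

/-- The projection `(1 - F) / 2` onto the antisymmetric vectors of `ℂ⁴ ⊗ ℂ⁴`, where `F` is the
flip. -/
noncomputable def antisymmetricProjection : Matrix (Fin 4 × Fin 4) (Fin 4 × Fin 4) ℂ :=
  (1 / 2 : ℂ) • (1 - (1 : Matrix (Fin 4 × Fin 4) (Fin 4 × Fin 4) ℂ).submatrix Prod.swap id)

theorem conjTranspose_antisymmetricProjection :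
    antisymmetricProjectionᴴ = antisymmetricProjection := by
  have hF : ((1 : Matrix (Fin 4 × Fin 4) (Fin 4 × Fin 4) ℂ).submatrix Prod.swap id)ᴴ =
      (1 : Matrix (Fin 4 × Fin 4) (Fin 4 × Fin 4) ℂ).submatrix Prod.swap id := by
    ext ⟨a, b⟩ ⟨c, d⟩
    simp [one_apply, and_comm, eq_comm]
  rw [antisymmetricProjection, conjTranspose_smul, conjTranspose_sub, hF, conjTranspose_one]
  simp

theorem antisymmetricProjection_mul_self :
    antisymmetricProjection * antisymmetricProjection = antisymmetricProjection := by
  have hF : (1 : Matrix (Fin 4 × Fin 4) (Fin 4 × Fin 4) ℂ).submatrix Prod.swap id *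
      (1 : Matrix (Fin 4 × Fin 4) (Fin 4 × Fin 4) ℂ).submatrix Prod.swap id = 1 := by
    ext i j
    rw [mul_apply, Finset.sum_eq_single i.swap (fun t _ ht => by simp [one_apply, ht.symm])
      (fun h => absurd (Finset.mem_univ _) h)]
    simp [one_apply]
  rw [antisymmetricProjection, smul_mul_smul_comm, sub_mul, mul_sub, mul_sub, hF, one_mul, one_mul,
    mul_one]
  module

/-- The normalisation of `1 + P`, for `P` the antisymmetric projection of a subspace `ℂ⁴ ⊗ ℂ⁴`, has
its eigenvalues in the ratio `1 : 2`, but its partial transpose is negative on the maximally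
entangled state of `ℂ⁴ ⊗ ℂ⁴`. -/
theorem not_LSStates_two_subset_APPT (hn : 4 ≤ n) (hk : 4 ≤ k) :
    ¬ LSStates n k 2 ⊆ APPT n k := by
  intro hsub
  let φ : Fin 4 × Fin 4 → Fin n × Fin k := Prod.map (Fin.castLE hn) (Fin.castLE hk)
  have hφ : Function.Injective φ :=
    Function.Injective.prodMap (Fin.castLE_injective hn) (Fin.castLE_injective hk)
  -- The isometric embedding of `ℂ⁴ ⊗ ℂ⁴` into `ℂⁿ ⊗ ℂᵏ`.
  let W : Matrix (Fin n × Fin k) (Fin 4 × Fin 4) ℂ := (1 : Matrix _ _ ℂ).submatrix id φ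
  have hW : Wᴴ * W = 1 := by
    ext i j
    simp [W, mul_apply, one_apply, hφ.eq_iff]
  let P := W * antisymmetricProjection * Wᴴ
  have hPsub : P.submatrix φ φ = antisymmetricProjection := by
    have : P.submatrix φ φ = Wᴴ * P * W := by
      ext i j
      simp [W, mul_apply, one_apply]
    rw [this]
    simp only [P, ← Matrix.mul_assoc, hW, Matrix.one_mul]
    rw [Matrix.mul_assoc, hW, Matrix.mul_one]
  have hPh : Pᴴ = P := by
    simp only [P, conjTranspose_mul, conjTranspose_conjTranspose, Matrix.mul_assoc]
    rw [conjTranspose_antisymmetricProjection]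
  have hPP : P * P = P := by
    have : P * P = W * (antisymmetricProjection * (Wᴴ * W) * antisymmetricProjection) * Wᴴ := by
      simp only [P, Matrix.mul_assoc]
    rw [this, hW, Matrix.mul_one, antisymmetricProjection_mul_self]
  have hP0 : P.PosSemidef := by
    have := posSemidef_conjTranspose_mul_self P
    rwa [hPh, hPP] at this
  have hP1 : (1 - P).PosSemidef := by
    have := posSemidef_conjTranspose_mul_self (1 - P)
    rwa [conjTranspose_sub, conjTranspose_one, hPh, mul_sub, sub_mul, sub_mul, one_mul, mul_one,
      one_mul, hPP, sub_self, sub_zero] at this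
  have hM : (1 + P).PosSemidef := PosSemidef.one.add hP0
  set c := (1 + P).trace.re with hc
  have hct : (1 + P).trace = c := by
    have := (Complex.nonneg_iff.mp hM.trace_nonneg).2
    exact Complex.ext rfl this.symm
  have hc0 : 0 < c := by
    have := (Complex.nonneg_iff.mp hP0.trace_nonneg).1
    rw [hc, trace_add, Complex.add_re, trace_one]
    have hnk : 0 < Fintype.card (Fin n × Fin k) := by
      simp only [Fintype.card_prod, Fintype.card_fin]
      positivity
    rw [Complex.natCast_re]
    positivity
  have hρ := inv_smul_mem_densityMatrices hM hc0 hct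
  have hc1 : (0 : ℂ) ≤ ((c⁻¹ : ℝ) : ℂ) := by exact_mod_cast (inv_pos.mpr hc0).le
  have hLS := mem_LSStates_two_of_posSemidef (by nlinarith) hρ (a := c⁻¹)
    (by
      rw [← smul_sub, add_sub_cancel_left]
      exact hP0.smul hc1)
    (by
      have : ((2 * c⁻¹ : ℝ) : ℂ) • (1 : Matrix (Fin n × Fin k) (Fin n × Fin k) ℂ) -
          ((c⁻¹ : ℝ) : ℂ) • (1 + P) = ((c⁻¹ : ℝ) : ℂ) • (1 - P) := by
        rw [Complex.ofReal_mul, Complex.ofReal_ofNat]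
        module
      rw [this]
      exact hP1.smul hc1)
  have hΓ := ((hsub hLS).2 1 (one_mem _)).2
  rw [one_mul, star_one, mul_one] at hΓ
  have h4 := (hΓ.submatrix (fun u : Fin 4 => φ (u, u)))
  have h5 := (Complex.nonneg_iff.mp ((posSemidef_iff_dotProduct_mulVec.mp h4).2 (fun _ => 1))).1
  have h6 : ∀ u v, P (φ (u, v)) (φ (v, u)) = antisymmetricProjection (u, v) (v, u) := fun u v =>
    congrFun (congrFun hPsub (u, v)) (v, u)
  have h7 : ∀ u v : Fin 4, partialTranspose (((c⁻¹ : ℝ) : ℂ) • (1 + P)) (φ (u, u)) (φ (v, v)) =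
      ((c⁻¹ * (if u = v then 1 else -(1 / 2)) : ℝ) : ℂ) := by
    intro u v
    have : partialTranspose (((c⁻¹ : ℝ) : ℂ) • (1 + P)) (φ (u, u)) (φ (v, v)) =
      ((c⁻¹ : ℝ) : ℂ) * ((1 : Matrix _ _ ℂ) (φ (u, v)) (φ (v, u)) + P (φ (u, v)) (φ (v, u))) := rfl
    have h1 : (1 : Matrix (Fin n × Fin k) (Fin n × Fin k) ℂ) (φ (u, v)) (φ (v, u)) =
        if u = v then 1 else 0 := by
      by_cases huv : u = v
      · rw [huv, one_apply_eq, if_pos rfl]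
      · rw [one_apply_ne (fun e => huv (Prod.ext_iff.mp (hφ e)).1), if_neg huv]
    rw [this, h6, h1]
    by_cases huv : u = v
    · subst huv
      simp [antisymmetricProjection, one_apply]
    · simp [huv, antisymmetricProjection, one_apply]
  simp only [mulVec, dotProduct, submatrix_apply, h7, Fin.sum_univ_four] at h5
  simp at h5
  have := inv_pos.mpr hc0
  linarith

/-- A Hermitian matrix of size `d` with `Tr A = Tr A² = 1` is at least `-(d - 2) / d`. -/
theorem posSemidef_one_add_smul {ι : Type} [Fintype ι] [DecidableEq ι] {A : Matrix ι ι ℂ}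
    (hA : A.IsHermitian) (h1 : A.trace = 1) (h2 : (A * A).trace = 1) (hd : 2 < Fintype.card ι) :
    (1 + ((Fintype.card ι / (Fintype.card ι - 2) : ℝ) : ℂ) • A).PosSemidef := by
  have hH : (1 + ((Fintype.card ι / (Fintype.card ι - 2) : ℝ) : ℂ) • A).IsHermitian := by
    refine isHermitian_one.add ?_
    rw [IsHermitian, conjTranspose_smul, hA]
    simp
  refine posSemidef_of_trace_nonneg hH fun x => ?_
  set Y := vecMulVec x (star x) with hY
  have hYh : Y.IsHermitian := (posSemidef_vecMulVec_self_star x).isHermitian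
  set d : ℝ := (Fintype.card ι : ℝ) with hdd
  have hd' : 2 < d := by simp only [hdd]; exact_mod_cast hd
  set r : ℝ := ∑ i, ‖x i‖ ^ 2 with hr
  have hYt : Y.trace = r := trace_vecMulVec_star x
  have hYY : (Y * Y).trace = (r : ℂ) ^ 2 := trace_vecMulVec_star_mul_self x
  have hr0 : 0 ≤ r := Finset.sum_nonneg fun i _ => sq_nonneg _
  -- Cauchy-Schwarz for `A` and `r - (d / 2) Y`, written as the nonnegativity of a squared norm; the
  -- factor `d / 2` makes both sides comparable, as `‖r - (d / 2) Y‖ = (d / 2) r`.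
  let H := ((d / 2 * r : ℝ) : ℂ) • A - (r : ℂ) • 1 + ((d / 2 : ℝ) : ℂ) • Y
  have hHh : Hᴴ = H := by
    simp only [H, conjTranspose_add, conjTranspose_sub, conjTranspose_smul, hA.eq, hYh.eq,
      conjTranspose_one]
    simp
  have hpos := (Complex.nonneg_iff.mp (posSemidef_conjTranspose_mul_self H).trace_nonneg).1
  rw [hHh] at hpos
  have hexp : (H * H).trace = ((d / 2 * r : ℝ) : ℂ) ^ 2 * 1 + (r : ℂ) ^ 2 * d +
      ((d / 2 : ℝ) : ℂ) ^ 2 * (r : ℂ) ^ 2 - 2 * (d / 2 * r : ℝ) * r * 1 +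
      2 * (d / 2 * r : ℝ) * (d / 2 : ℝ) * (A * Y).trace - 2 * r * (d / 2 : ℝ) * r := by
    have hone : (1 : Matrix ι ι ℂ).trace = (d : ℂ) := by simp [hdd]
    simp only [H, add_mul, mul_add, sub_mul, mul_sub, smul_mul_assoc, mul_smul_comm, one_mul,
      mul_one, trace_add, trace_sub, trace_smul, smul_eq_mul, trace_mul_comm Y A, h1, h2, hYt,
      hYY, hone]
    ring
  set q : ℝ := (A * Y).trace.re with hq
  have hre : 0 ≤ d / 2 * r * ((d - 2) * r + d * q) := by
    have e : (H * H).trace.re = d / 2 * r * ((d - 2) * r + d * q) := by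
      have e' : (H * H).trace = ((d / 2 * r * ((d - 2) * r) : ℝ) : ℂ) +
          ((d / 2 * r * d : ℝ) : ℂ) * (A * Y).trace := by
        rw [hexp]
        push_cast
        ring
      rw [e', Complex.add_re, Complex.ofReal_re, Complex.re_ofReal_mul, ← hq]
      ring
    rwa [e] at hpos
  rw [add_mul, one_mul, smul_mul_assoc, trace_add, trace_smul, hYt, smul_eq_mul, Complex.add_re,
    Complex.ofReal_re, Complex.re_ofReal_mul, ← hq]
  rcases hr0.eq_or_lt with h0 | h0
  · have hx : x = 0 := by
      funext i
      have := (Finset.sum_eq_zero_iff_of_nonneg (fun i _ => sq_nonneg ‖x i‖)).mp h0.symm i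
        (Finset.mem_univ i)
      simpa using this
    simp [hq, hY, hx, ← h0]
  · have e : 0 ≤ (d - 2) * r + d * q := nonneg_of_mul_nonneg_right hre (by positivity)
    have e2 : r + d / (d - 2) * q = ((d - 2) * r + d * q) / (d - 2) := by
      have : d - 2 ≠ 0 := by linarith
      field_simp
    rw [e2]
    exact div_nonneg e (by linarith)

theorem partialTranspose_one :
    partialTranspose (1 : Matrix (Fin n × Fin k) (Fin n × Fin k) ℂ) = 1 := by
  ext ⟨i, a⟩ ⟨j, b⟩
  simp [partialTranspose, one_apply, eq_comm]

/-- The witness has its eigenvalues in the ratio `1 + s : 1 : … : 1` with `s = d / (d - 2) > 1`. It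
is close enough to the maximally mixed state to be absolutely PPT. -/
theorem not_APPT_subset_LSStates_two (hn : 2 ≤ n) (hk : 2 ≤ k) :
    ¬ APPT n k ⊆ LSStates n k 2 := by
  intro hsub
  have hd : 4 ≤ Fintype.card (Fin n × Fin k) := by simp; nlinarith
  let p : Fin n × Fin k := (⟨0, by omega⟩, ⟨0, by omega⟩)
  set d : ℝ := (Fintype.card (Fin n × Fin k) : ℝ) with hdd
  have hd' : 4 ≤ d := by simp only [hdd]; exact_mod_cast hd
  let s : ℝ := d / (d - 2)
  have hs : 1 < s := by rw [one_lt_div (by linarith)]; linarith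
  let E : Matrix (Fin n × Fin k) (Fin n × Fin k) ℂ := single p p 1
  have hE : E.PosSemidef := by
    simp only [E]
    rw [← diagonal_single]
    exact PosSemidef.diagonal (by intro i; by_cases hi : i = p <;> simp [hi])
  have hs0 : (0 : ℂ) ≤ ((s : ℝ) : ℂ) := by exact_mod_cast (by linarith : 0 ≤ s)
  have hM : (1 + (s : ℂ) • E).PosSemidef := PosSemidef.one.add (hE.smul hs0)
  let c : ℝ := d + s
  have hc : 0 < c := by simp only [c]; linarith
  have hct : (1 + (s : ℂ) • E).trace = c := by
    simp [E, c, hdd]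
  have hc1 : (0 : ℂ) ≤ ((c⁻¹ : ℝ) : ℂ) := by exact_mod_cast (inv_pos.mpr hc).le
  have hρ := inv_smul_mem_densityMatrices hM hc hct
  set ρ := ((c⁻¹ : ℝ) : ℂ) • (1 + (s : ℂ) • E) with hρd
  have hAPPT : ρ ∈ APPT n k := by
    refine ⟨hρ, fun U hU => ⟨conj_mem_densityMatrices hU hρ, ?_⟩⟩
    have hU' := mem_unitaryGroup_iff'.mp hU
    set A := partialTranspose (U * E * star U)
    have e1 : U * ρ * star U = ((c⁻¹ : ℝ) : ℂ) • (1 + (s : ℂ) • (U * E * star U)) := by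
      rw [hρd, mul_smul_comm, smul_mul_assoc, mul_add, add_mul, mul_one,
        mem_unitaryGroup_iff.mp hU, mul_smul_comm, smul_mul_assoc]
    have e2 : partialTranspose (U * ρ * star U) = ((c⁻¹ : ℝ) : ℂ) • (1 + (s : ℂ) • A) := by
      have e3 : partialTranspose (((c⁻¹ : ℝ) : ℂ) • (1 + (s : ℂ) • (U * E * star U))) =
          ((c⁻¹ : ℝ) : ℂ) • (partialTranspose 1 + (s : ℂ) • A) := rfl
      rw [e1, e3, partialTranspose_one]
    rw [e2]
    refine PosSemidef.smul (posSemidef_one_add_smul ?_ ?_ ?_ (by omega)) hc1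
    · exact isHermitian_partialTranspose (hE.mul_mul_conjTranspose_same U).isHermitian
    · rw [trace_partialTranspose, trace_mul_comm, ← mul_assoc, hU', one_mul]
      simp [E]
    · rw [trace_partialTranspose_mul, partialTranspose_partialTranspose, mul_assoc (U * E),
        ← mul_assoc (star U), ← mul_assoc (star U), hU', one_mul, ← mul_assoc, trace_mul_comm,
        ← mul_assoc, ← mul_assoc, hU', one_mul]
      simp [E]
  have h := hρ.1.isHermitian
  obtain ⟨-, hd0, h2⟩ := (mem_statesWithSpectrumIn_LS_iff h).mp (hsub hAPPT)
  rw [sum_last_two (by omega)] at h2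
  have hlow : ∀ i, c⁻¹ ≤ h.eigenvalues₀ i := fun i => by
    rw [eigenvalues₀_eq_eigenvalues]
    refine le_eigenvalues_of_posSemidef_sub h ?_ _
    rw [hρd, ← smul_sub, add_sub_cancel_left]
    exact (hE.smul hs0).smul hc1
  have htop : c⁻¹ * (1 + s) ≤ h.eigenvalues₀ ⟨0, hd0⟩ := by
    have := trace_mul_le_eigenvalues₀_zero h hd0 hE
    have e : (ρ * E).trace = ((c⁻¹ * (1 + s) : ℝ) : ℂ) := by
      rw [hρd, smul_mul_assoc, trace_smul, add_mul, one_mul, trace_add, smul_mul_assoc, trace_smul]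
      simp [E]
    have hEt : E.trace.re = 1 := by simp [E]
    rwa [e, Complex.ofReal_re, hEt, mul_one] at this
  have hsum : ∑ i, (h.eigenvalues₀ i - c⁻¹) = c⁻¹ * s := by
    rw [Finset.sum_sub_distrib, sum_eigenvalues₀, hρ.2]
    simp only [Finset.sum_const, Finset.card_univ, Fintype.card_fin, nsmul_eq_mul, Complex.one_re]
    rw [← hdd]
    field_simp
    simp only [c]
    ring
  have h0 : (⟨0, hd0⟩ : Fin (Fintype.card (Fin n × Fin k))) ∉
      ({⟨Fintype.card (Fin n × Fin k) - 2, by omega⟩,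
        ⟨Fintype.card (Fin n × Fin k) - 1, by omega⟩} : Finset _) := by
    simp only [Finset.mem_insert, Finset.mem_singleton, Fin.mk.injEq]
    omega
  have h1 : (⟨Fintype.card (Fin n × Fin k) - 2, by omega⟩ : Fin (Fintype.card (Fin n × Fin k))) ≠
      ⟨Fintype.card (Fin n × Fin k) - 1, by omega⟩ := by
    simp only [ne_eq, Fin.mk.injEq]
    omega
  -- The excess over the lower bound `c⁻¹` has total `c⁻¹ * s`, all used by the top eigenvalue.
  have hthree := Finset.sum_le_sum_of_subset_of_nonneg (f := fun i => h.eigenvalues₀ i - c⁻¹)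
    (Finset.subset_univ {⟨0, hd0⟩, ⟨Fintype.card (Fin n × Fin k) - 2, by omega⟩,
      ⟨Fintype.card (Fin n × Fin k) - 1, by omega⟩}) fun i _ _ => sub_nonneg.mpr (hlow i)
  rw [hsum, Finset.sum_insert h0, Finset.sum_pair h1] at hthree
  have := mul_lt_mul_of_pos_left hs (inv_pos.mpr hc)
  linarith

end Counterexamples
end BipartiteSpectra

theorem mainTheorem4 (n k : ℕ) (hn : 2 ≤ n) (hk : 2 ≤ k) :
    (3 ≤ n → 3 ≤ k →
      BipartiteSpectra.APPT n k ⊆ BipartiteSpectra.LSStates n k 3 ∧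
      BipartiteSpectra.LSStates n k 3 ⊆ BipartiteSpectra.LSStates n k k ∧
      BipartiteSpectra.LSStates n k k ⊆ BipartiteSpectra.ARED n k ∧
      BipartiteSpectra.ARED n k ⊆ BipartiteSpectra.LSStates n k (2 * k - 1)) ∧
    BipartiteSpectra.APPT n k ⊆ BipartiteSpectra.LSStates n k 3 ∧
    (min n k = 2 ∨ min n k = 3 →
      BipartiteSpectra.LSStates n k 2 ⊆ BipartiteSpectra.APPT n k) ∧
    (4 ≤ min n k →
      ¬ BipartiteSpectra.LSStates n k 2 ⊆ BipartiteSpectra.APPT n k) ∧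
    ¬ BipartiteSpectra.APPT n k ⊆ BipartiteSpectra.LSStates n k 2 ∧
    BipartiteSpectra.LSStates n k k ⊆ BipartiteSpectra.ARED n k ∧
    BipartiteSpectra.ARED n k ⊆ BipartiteSpectra.LSStates n k (2 * k - 1) := by
  have h1 := BipartiteSpectra.APPT_subset_LSStates_three hn hk
  have h4 : BipartiteSpectra.LSStates n k k ⊆ BipartiteSpectra.ARED n k :=
    BipartiteSpectra.statesWithSpectrumIn_LS_subset_absolutely
      (BipartiteSpectra.LSStates_subset_RED (by omega) (by omega))
  have h5 := BipartiteSpectra.ARED_subset_LSStates hn hk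
  refine ⟨fun _ hk3 => ⟨h1, BipartiteSpectra.statesWithSpectrumIn_LS_mono hk3, h4, h5⟩, h1,
    fun h => ?_, fun h => ?_, BipartiteSpectra.not_APPT_subset_LSStates_two hn hk, h4, h5⟩
  · exact BipartiteSpectra.statesWithSpectrumIn_LS_subset_absolutely
      (BipartiteSpectra.LSStates_two_subset_PPT hn hk (by omega))
  · exact BipartiteSpectra.not_LSStates_two_subset_APPT (by omega) (by omega)
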